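/- Let $n,k\ge 0$ be integers and consider $n$ qubits with Hilbert space $(\mathbb{C}^2)^{\otimes n}$. An operator is called $k$-local if it acts non-trivially on at most $k$ qubits (i.e. it is the tensor product of an operator on some set of at most $k$ qubits with the identity on the remaining qubits), and rotationally-invariant if it commutes with $U^{\otimes n}$ for every $U\in \mathrm{SU}(2)$. Let $\mathfrak{v}_k$ be the real Lie algebra, with the commutator as bracket, generated by all operators $A$ on $(\mathbb{C}^2)^{\otimes n}$ that are skew-Hermitian ($A+A^\dagger=0$), $k$-local and rotationally-invariant. For qubits $r\neq s$ put $R_{r,s}=\frac12\sum_{v=x,y,z}\sigma^{(v)}_r\sigma^{(v)}_s$, where $\sigma^{(v)}_r$ is the Pauli matrix $\sigma^{(v)}$ acting on qubit $r$ (tensored with the identity on all other qubits). Put $C_0=\mathbb{I}$ and, for even $l\ge 2$, $$C_l=\frac{1}{(l/2)!}\sum_{i_1,\dots,i_l} R_{i_1,i_2}R_{i_3,i_4}\cdots R_{i_{l-1},i_l},$$ where the sum is over all $l$-tuples of pairwise distinct qubits $i_1,\dots,i_l\in\{1,\dots,n\}$ (so $C_l=0$ if $l>n$). Then the center $\mathfrak{z}_k=\{A\in\mathfrak{v}_k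 : [A,F]=0 \text{ for all } F\in\mathfrak{v}_k\}$ is $$\mathfrak{z}_k=\operatorname{span}_{\mathbb{R}}\{\,iC_l : l=0,2,4,\dots,2\lfloor k/2\rfloor\,\}.$$ In particular, if $k\le n$, then $\dim_{\mathbb{R}}\mathfrak{z}_k=\lfloor k/2\rfloor+1$. -/

import Mathlib

open scoped Matrix

attribute [local instance 100] LieRing.ofAssociativeRing

noncomputable section

namespace Qubits

/-- Linear operators on the Hilbert space `(ℂ²)^{⊗ n}` of `n` qubits, written as matrices in the
computational basis `|x⟩`, `x : Fin n → Fin 2`. -/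
abbrev Operator (n : ℕ) : Type := Matrix (Fin n → Fin 2) (Fin n → Fin 2) ℂ

/-- The Pauli matrices `σ^{(x)}`, `σ^{(y)}`, `σ^{(z)}`, indexed by `0`, `1`, `2`. -/
def pauli : Fin 3 → Matrix (Fin 2) (Fin 2) ℂ :=
  ![!![0, 1; 1, 0], !![0, -Complex.I; Complex.I, 0], !![1, 0; 0, -1]]

/-- The tensor power `U^{⊗ n}` of a single-qubit operator `U`. -/
def tensorPower (n : ℕ) (U : Matrix (Fin 2) (Fin 2) ℂ) : Operator n :=
  Matrix.of fun x y => ∏ i, U (x i) (y i)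

/-- The single-qubit operator `M` acting on qubit `r`, tensored with the identity on the other
qubits. -/
def onQubit {n : ℕ} (r : Fin n) (M : Matrix (Fin 2) (Fin 2) ℂ) : Operator n :=
  Matrix.of fun x y => if ∀ i, i ≠ r → x i = y i then M (x r) (y r) else 0

/-- The exchange interaction `R_{rs} = (1/2) ∑_v σ_r^{(v)} σ_s^{(v)}`. -/
def exchange {n : ℕ} (r s : Fin n) : Operator n :=
  (1 / 2 : ℂ) • ∑ v : Fin 3, onQubit r (pauli v) * onQubit s (pauli v)

/-- The operator `C_l = (1 / (l/2)!) ∑ R_{i_1,i_2} ⋯ R_{i_{l-1},i_l}` for even `l`, the sum being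
over all `l`-tuples of distinct qubits. For `l = 0` there is one (empty) tuple and `C_0 = 1`; for
`l > n` there is no such tuple and `C_l = 0`. -/
def opC (n l : ℕ) : Operator n :=
  (1 / ((l / 2).factorial : ℂ)) •
    ∑ i : Fin l ↪ Fin n,
      (List.ofFn fun a : Fin (l / 2) =>
        exchange (i ⟨2 * a.val, by omega⟩) (i ⟨2 * a.val + 1, by omega⟩)).prod

/-- `A` acts trivially outside the set `S` of qubits: it is `B ⊗ 1` for an operator `B` on the
qubits in `S`. -/
def ActsOn {n : ℕ} (S : Finset (Fin n)) (A : Operator n) : Prop :=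
  ∃ B : Matrix (S → Fin 2) (S → Fin 2) ℂ, ∀ x y : Fin n → Fin 2,
    A x y = if ∀ i, i ∉ S → x i = y i then B (fun i => x i) (fun i => y i) else 0

/-- `A` is `k`-local: it acts nontrivially on at most `k` qubits. -/
def IsLocal {n : ℕ} (k : ℕ) (A : Operator n) : Prop :=
  ∃ S : Finset (Fin n), S.card ≤ k ∧ ActsOn S A

/-- `A` is rotationally invariant: it commutes with `U^{⊗ n}` for every `U ∈ SU(2)`. -/
def IsRotInvariant {n : ℕ} (A : Operator n) : Prop :=
  ∀ U ∈ Matrix.specialUnitaryGroup (Fin 2) ℂ, Commute A (tensorPower n U)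

/-- The real Lie algebra `𝔳_k` (under the commutator bracket) generated by the `k`-local
rotationally invariant skew-Hermitian operators on `n` qubits. -/
def localLieAlgebra (n k : ℕ) : LieSubalgebra ℝ (Operator n) :=
  LieSubalgebra.lieSpan ℝ (Operator n)
    {A | A + Aᴴ = 0 ∧ IsLocal k A ∧ IsRotInvariant A}

end Qubits

end

/-! To an operator `X` attach the form `f_X(λ) = tr (X diag(λ)^{⊗n})` (`diagTrace`), playing the
role of a character. Three facts about it decide the center. (1) Locality survives brackets: a
rotationally invariant operator on at most `k` qubits has `f_X` in the span of `(λ₀+λ₁)^{n-2j}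
(λ₀-λ₁)^{2j}` with `2j ≤ k`, since traced-out qubits give factors `λ₀+λ₁` and the rest is symmetric
in `λ₀, λ₁`. A bracket of invariant operators has `f = 0` by cyclicity of the trace. So every
element of `𝔳_k` obeys the same bound (`mem_localLieAlgebra_properties`). (2) `f_X` determines `X`
when `X` is both rotation- and permutation-invariant (`IsRotInvariant.eq_zero`), by polarization and
the spectral theorem. (3) For even `l ≤ n`, `f_{C_l}` is a nonzero multiple of the form with `2j =
l` (`diagTrace_opC`). If `k ≥ 2`, a central element commutes with every `R_{rs}`, which is a qubit
swap minus `1/2`, so it is permutation-invariant; if `k ≤ 1`, `𝔳_k` consists of scalars. By (1)-(3)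
it is a complex combination of the `C_l`, and skew-Hermiticity makes the coefficients imaginary.
Conversely `C_l` is permutation-invariant, so by one half of Schur–Weyl duality it commutes with
every rotationally invariant operator. -/

namespace Qubits

/-! ### Tensor products of single-qubit operators -/

/-- The tensor product `⊗ᵢ Nᵢ` of a family of single-qubit operators. -/
def tensorFamily {n : ℕ} (N : Fin n → Matrix (Fin 2) (Fin 2) ℂ) : Operator n :=
  Matrix.of fun x y => ∏ i, N i (x i) (y i)

theorem tensorPower_eq_tensorFamily (n : ℕ) (U : Matrix (Fin 2) (Fin 2) ℂ) :
    tensorPower n U = tensorFamily fun _ => U := rfl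

theorem tensorFamily_mul {n : ℕ} (N N' : Fin n → Matrix (Fin 2) (Fin 2) ℂ) :
    tensorFamily N * tensorFamily N' = tensorFamily fun i => N i * N' i := by
  ext x y
  simp only [tensorFamily, Matrix.mul_apply, Matrix.of_apply, ← Finset.prod_mul_distrib]
  rw [Finset.prod_univ_sum, Fintype.piFinset_univ]

theorem trace_tensorFamily {n : ℕ} (N : Fin n → Matrix (Fin 2) (Fin 2) ℂ) :
    (tensorFamily N).trace = ∏ i, (N i).trace := by
  simp only [tensorFamily, Matrix.trace, Matrix.diag_apply, Matrix.of_apply]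
  rw [Finset.prod_univ_sum, Fintype.piFinset_univ]

theorem tensorFamily_one {n : ℕ} : tensorFamily (fun _ : Fin n => 1) = 1 := by
  ext x y
  simp only [tensorFamily, Matrix.of_apply, Matrix.one_apply]
  by_cases h : x = y
  · simp [h]
  · rw [if_neg h]
    obtain ⟨i, hi⟩ := Function.ne_iff.mp h
    exact Finset.prod_eq_zero (Finset.mem_univ i) (if_neg hi)

theorem conjTranspose_tensorFamily {n : ℕ} (N : Fin n → Matrix (Fin 2) (Fin 2) ℂ) :
    (tensorFamily N)ᴴ = tensorFamily fun i => (N i)ᴴ := by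
  ext x y
  simp [tensorFamily, Matrix.conjTranspose_apply]

theorem tensorPower_mul (n : ℕ) (U V : Matrix (Fin 2) (Fin 2) ℂ) :
    tensorPower n (U * V) = tensorPower n U * tensorPower n V := by
  simp only [tensorPower_eq_tensorFamily, tensorFamily_mul]

theorem tensorPower_one (n : ℕ) : tensorPower n 1 = 1 := tensorFamily_one

theorem tensorPower_smul (n : ℕ) (c : ℂ) (U : Matrix (Fin 2) (Fin 2) ℂ) :
    tensorPower n (c • U) = c ^ n • tensorPower n U := by
  ext x y
  simp [tensorPower, Finset.prod_mul_distrib]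

/-! ### Permutation invariance and polarization -/

/-- An operator is permutation-invariant if it commutes with permutations of the qubits. -/
def IsPermInvariant {n : ℕ} (D : Operator n) : Prop :=
  ∀ (σ : Equiv.Perm (Fin n)) (x y : Fin n → Fin 2), D (x ∘ σ) (y ∘ σ) = D x y

/-- Equal multiplicities mean that corresponding fibres of `w` and `w'` have equal size; bijections
between them glue to `σ`. -/
theorem exists_perm_of_sum_single_eq {n : ℕ} {ι : Type*} [DecidableEq ι] {w w' : Fin n → ι}
    (h : ∑ i, Finsupp.single (w i) 1 = ∑ i, Finsupp.single (w' i) 1) :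
    ∃ σ : Equiv.Perm (Fin n), w' ∘ σ = w := by
  have hc : ∀ c, Nonempty ({i // w i = c} ≃ {i // w' i = c}) := by
    intro c
    have := DFunLike.congr_fun h c
    simp only [Finsupp.coe_finsetSum, Finset.sum_apply, Finsupp.single_apply,
      Finset.sum_boole, Nat.cast_id] at this
    refine ⟨Fintype.equivOfCardEq ?_⟩
    rw [Fintype.card_subtype, Fintype.card_subtype, this]
  exact ⟨Equiv.ofFiberEquiv fun c => (hc c).some,
    funext fun i => Equiv.ofFiberEquiv_map (fun c => (hc c).some) i⟩

/-- Polarization: if a form of degree `n` vanishes identically, then so does the pairing of its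
coefficients with symmetric ones. -/
theorem sum_mul_eq_zero_of_symmetric {n : ℕ} {ι : Type*} [DecidableEq ι] [Fintype ι]
    (c D : (Fin n → ι) → ℂ) (hc : ∀ M : ι → ℂ, ∑ w, c w * ∏ i, M (w i) = 0)
    (hD : ∀ (σ : Equiv.Perm (Fin n)) w, D (w ∘ σ) = D w) : ∑ w, c w * D w = 0 := by
  let t : (Fin n → ι) → (ι →₀ ℕ) := fun w => ∑ i, Finsupp.single (w i) 1
  have hfac : D.FactorsThrough t := by
    intro w w' h
    obtain ⟨σ, rfl⟩ := exists_perm_of_sum_single_eq h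
    exact hD σ w'
  -- The vanishing form is the zero polynomial, so the `c w` sum to zero over each class of words
  -- with the same multiset of letters; `D` is constant on such a class.
  have hP : ∑ w, MvPolynomial.monomial (t w) (c w) = 0 := by
    apply MvPolynomial.funext
    intro M
    rw [map_sum, map_zero, ← hc M]
    refine Finset.sum_congr rfl fun w _ => ?_
    rw [show c w = c w * 1 by rw [mul_one], ← MvPolynomial.C_mul_monomial,
      MvPolynomial.monomial_sum_one, map_mul, map_prod]
    simp [MvPolynomial.eval_monomial]
  have key : ∑ m ∈ Finset.univ.image t,
      (∑ w, if t w = m then c w else 0) * Function.extend t D 0 m = 0 := by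
    refine Finset.sum_eq_zero fun m _ => ?_
    have h := congrArg (MvPolynomial.coeff m) hP
    simp only [MvPolynomial.coeff_sum, MvPolynomial.coeff_monomial, MvPolynomial.coeff_zero] at h
    rw [h, zero_mul]
  rw [← key]
  simp only [Finset.sum_mul, ite_mul, zero_mul]
  rw [Finset.sum_comm]
  refine Finset.sum_congr rfl fun w _ => ?_
  rw [Finset.sum_ite_eq, if_pos (Finset.mem_image_of_mem t (Finset.mem_univ w)),
    hfac.extend_apply]

theorem map_eq_sum {n : ℕ} (φ : Operator n →ₗ[ℂ] ℂ) (A : Operator n) :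
    φ A = ∑ x, ∑ y, A x y * φ (Matrix.single x y 1) := by
  conv_lhs => rw [Matrix.matrix_eq_sum_single A]
  simp only [map_sum]
  refine Finset.sum_congr rfl fun x _ => Finset.sum_congr rfl fun y _ => ?_
  rw [← smul_eq_mul, ← map_smul, Matrix.smul_single, smul_eq_mul, mul_one]

/-- Dual form of the statement that permutation-invariant operators lie in the span of the tensor
powers. Matrix entries are read as words in the alphabet `Fin 2 × Fin 2`. -/
theorem IsPermInvariant.map_eq_zero {n : ℕ} {D : Operator n} (hD : IsPermInvariant D)
    (φ : Operator n →ₗ[ℂ] ℂ) (hφ : ∀ M, φ (tensorPower n M) = 0) : φ D = 0 := by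
  let e : (Fin n → Fin 2 × Fin 2) ≃ (Fin n → Fin 2) × (Fin n → Fin 2) :=
    Equiv.arrowProdEquivProdArrow _ _ _
  have hsum : ∀ A : Operator n, φ A = ∑ w : Fin n → Fin 2 × Fin 2,
      φ (Matrix.single (e w).1 (e w).2 1) * A (e w).1 (e w).2 := by
    intro A
    rw [map_eq_sum, ← Fintype.sum_prod_type', ← e.sum_comp]
    exact Finset.sum_congr rfl fun w _ => mul_comm _ _
  rw [hsum]
  refine sum_mul_eq_zero_of_symmetric _ (fun w => D (e w).1 (e w).2) (fun M => ?_)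
    fun σ w => hD σ (e w).1 (e w).2
  rw [← hφ (Matrix.of fun a b => M (a, b)), hsum]
  rfl

/-! ### From SU(2) to all tensor powers -/

theorem map_tensorPower_add_smul_eq_zero {n : ℕ} (φ : Operator n →ₗ[ℂ] ℂ)
    (M N : Matrix (Fin 2) (Fin 2) ℂ)
    (h : ∀ s : ℝ, φ (tensorPower n (M + (s : ℂ) • N)) = 0) (s : ℂ) :
    φ (tensorPower n (M + s • N)) = 0 := by
  -- The expression is polynomial in `s`, so vanishing for real `s` forces vanishing for complex
  -- `s`. This passes from a real form of the 2×2 matrices (quaternions, Hermitian matrices) to all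
  -- of them.
  let P : Polynomial ℂ := ∑ x : Fin n → Fin 2, ∑ y : Fin n → Fin 2,
    (∏ i, (Polynomial.C (M (x i) (y i)) + Polynomial.X * Polynomial.C (N (x i) (y i)))) *
      Polynomial.C (φ (Matrix.single x y 1))
  have hP : ∀ s : ℂ, P.eval s = φ (tensorPower n (M + s • N)) := by
    intro s
    rw [map_eq_sum]
    simp [P, Polynomial.eval_finsetSum, Polynomial.eval_prod, tensorPower, mul_comm s]
  have h0 : P = 0 := by
    apply Polynomial.eq_of_infinite_eval_eq
    refine Set.Infinite.mono ?_ (Set.infinite_range_of_injective Complex.ofReal_injective)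
    rintro _ ⟨s, rfl⟩
    exact (hP s).trans ((h s).trans Polynomial.eval_zero.symm)
  rw [← hP, h0, Polynomial.eval_zero]

/-- The real quaternion `α + β j` as a complex matrix. -/
def quaternionMatrix (α β : ℂ) : Matrix (Fin 2) (Fin 2) ℂ :=
  !![α, β; -star β, star α]

/-- A quaternion matrix is its norm times an element of SU(2). -/
theorem IsRotInvariant.commute_quaternion {n : ℕ} {X : Operator n} (hX : IsRotInvariant X)
    (α β : ℂ) : Commute X (tensorPower n (quaternionMatrix α β)) := by
  set r : ℝ := Real.sqrt (Complex.normSq α + Complex.normSq β) with hr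
  have hnn : 0 ≤ Complex.normSq α + Complex.normSq β :=
    add_nonneg (Complex.normSq_nonneg _) (Complex.normSq_nonneg _)
  have hr2 : r ^ 2 = Complex.normSq α + Complex.normSq β := Real.sq_sqrt hnn
  by_cases h0 : r = 0
  · have h1 : Complex.normSq α = 0 := by
      nlinarith [Complex.normSq_nonneg α, Complex.normSq_nonneg β]
    have h2 : Complex.normSq β = 0 := by
      nlinarith [Complex.normSq_nonneg α, Complex.normSq_nonneg β]
    rw [map_eq_zero] at h1 h2
    have : quaternionMatrix α β = (0 : ℂ) • 1 := by
      ext i j; fin_cases i <;> fin_cases j <;> simp [quaternionMatrix, h1, h2]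
    rw [this, tensorPower_smul, tensorPower_one]
    exact (Commute.one_right X).smul_right _
  · have hrc : (r : ℂ) ≠ 0 := by exact_mod_cast h0
    have hsc : (r : ℂ) ^ 2 = α * star α + β * star β := by
      rw [← Complex.ofReal_pow, hr2, Complex.ofReal_add, Complex.star_def, Complex.mul_conj,
        Complex.mul_conj]
    have hfac : quaternionMatrix α β =
        (r : ℂ) • quaternionMatrix (α / r) (β / r) := by
      ext i j; fin_cases i <;> fin_cases j <;> simp [quaternionMatrix] <;> field_simp
    have hU : quaternionMatrix (α / r) (β / r) ∈ Matrix.specialUnitaryGroup (Fin 2) ℂ := by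
      rw [Matrix.mem_specialUnitaryGroup_iff, Matrix.mem_unitaryGroup_iff]
      simp only [Complex.star_def] at hsc
      constructor
      · ext i j
        fin_cases i <;> fin_cases j <;>
          simp [quaternionMatrix, Matrix.mul_apply, Matrix.star_apply, Fin.sum_univ_two] <;>
          field_simp <;>
          first | linear_combination -hsc | ring1
      · simp [quaternionMatrix, Matrix.det_fin_two]
        field_simp
        linear_combination -hsc
    rw [hfac, tensorPower_smul]
    exact (hX _ hU).smul_right _

/-- A rotationally invariant operator commutes with all tensor powers. -/
theorem IsRotInvariant.commute_tensorPower {n : ℕ} {X : Operator n} (hX : IsRotInvariant X)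
    (M : Matrix (Fin 2) (Fin 2) ℂ) : Commute X (tensorPower n M) := by
  -- Components of `M` in the decomposition of the 2×2 complex matrices as `ℍ ⊕ iℍ`.
  let q₁ := quaternionMatrix ((M 0 0 + star (M 1 1)) / 2) ((M 0 1 - star (M 1 0)) / 2)
  let q₂ := quaternionMatrix ((M 0 0 - star (M 1 1)) / (2 * Complex.I))
    ((M 0 1 + star (M 1 0)) / (2 * Complex.I))
  have hM : M = q₁ + Complex.I • q₂ := by
    have hI := Complex.I_sq
    ext i j
    fin_cases i <;> fin_cases j <;> simp [q₁, q₂, quaternionMatrix] <;> field_simp <;>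
      ring_nf
  rw [commute_iff_eq, ← sub_eq_zero]
  ext x y
  let φ : Operator n →ₗ[ℂ] ℂ :=
    (Matrix.entryLinearMap ℂ ℂ x y) ∘ₗ (LinearMap.mulLeft ℂ X - LinearMap.mulRight ℂ X)
  have h := map_tensorPower_add_smul_eq_zero φ q₁ q₂ (fun s => ?_) Complex.I
  · rw [← hM] at h
    exact h
  · have : q₁ + (s : ℂ) • q₂ = quaternionMatrix
        ((M 0 0 + star (M 1 1)) / 2 + s * ((M 0 0 - star (M 1 1)) / (2 * Complex.I)))
        ((M 0 1 - star (M 1 0)) / 2 + s * ((M 0 1 + star (M 1 0)) / (2 * Complex.I))) := by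
      ext i j
      fin_cases i <;> fin_cases j <;> simp [q₁, q₂, quaternionMatrix]
      all_goals ring
    rw [this]
    have hc := (hX.commute_quaternion
        ((M 0 0 + star (M 1 1)) / 2 + s * ((M 0 0 - star (M 1 1)) / (2 * Complex.I)))
        ((M 0 1 - star (M 1 0)) / 2 + s * ((M 0 1 + star (M 1 0)) / (2 * Complex.I)))).eq
    rw [← sub_eq_zero] at hc
    exact congrFun (congrFun hc x) y

theorem IsRotInvariant.commute_of_isPermInvariant {n : ℕ} {X D : Operator n}
    (hX : IsRotInvariant X) (hD : IsPermInvariant D) : Commute X D := by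
  rw [commute_iff_eq, ← sub_eq_zero]
  ext x y
  refine hD.map_eq_zero
    ((Matrix.entryLinearMap ℂ ℂ x y) ∘ₗ (LinearMap.mulLeft ℂ X - LinearMap.mulRight ℂ X))
    fun M => ?_
  simp [(hX.commute_tensorPower M).eq]

/-! ### The trace form of an operator -/

/-- The function `λ ↦ tr (X diag(λ)^{⊗ n})` of an operator `X`. -/
def diagTrace (n : ℕ) : Operator n →ₗ[ℂ] (Fin 2 → ℂ) → ℂ where
  toFun X l := (X * tensorPower n (Matrix.diagonal l)).trace
  map_add' X Y := by ext l; simp [add_mul]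
  map_smul' c X := by ext l; simp

theorem diagTrace_apply {n : ℕ} (X : Operator n) (l : Fin 2 → ℂ) :
    diagTrace n X l = (X * tensorPower n (Matrix.diagonal l)).trace := rfl

/-- Diagonalize `M`; cyclicity of the trace and invariance of `X` cancel the eigenvector unitaries.
-/
theorem IsRotInvariant.trace_mul_tensorPower_hermitian {n : ℕ} {X : Operator n}
    (hX : IsRotInvariant X) (hd : diagTrace n X = 0) {M : Matrix (Fin 2) (Fin 2) ℂ}
    (hM : M.IsHermitian) : (X * tensorPower n M).trace = 0 := by
  have hs := hM.spectral_theorem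
  rw [Unitary.conjStarAlgAut_apply] at hs
  have hU : star (hM.eigenvectorUnitary : Matrix (Fin 2) (Fin 2) ℂ) * hM.eigenvectorUnitary = 1 :=
    Unitary.coe_star_mul_self _
  have hX' := (hX.commute_tensorPower (star (hM.eigenvectorUnitary : Matrix (Fin 2) (Fin 2) ℂ))).eq
  rw [hs, tensorPower_mul, tensorPower_mul, ← mul_assoc, Matrix.trace_mul_comm, ← mul_assoc,
    ← mul_assoc, ← hX', mul_assoc X, ← tensorPower_mul, hU, tensorPower_one, mul_one]
  exact congrFun hd _

theorem IsPermInvariant.conjTranspose {n : ℕ} {D : Operator n} (hD : IsPermInvariant D) :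
    IsPermInvariant Dᴴ := fun σ x y => by
  simp only [Matrix.conjTranspose_apply, hD σ y x]

open scoped ComplexOrder in
/-- A symmetric operator is determined by the traces `tr (X diag(λ)^{⊗ n})`. -/
theorem IsRotInvariant.eq_zero {n : ℕ} {X : Operator n} (hX : IsRotInvariant X)
    (hP : IsPermInvariant X) (hd : diagTrace n X = 0) : X = 0 := by
  -- With `φ Z = tr (X Z)`, vanishing on tensor powers gives `tr (X Xᴴ) = 0`, hence `X = 0`.
  let φ : Operator n →ₗ[ℂ] ℂ := Matrix.traceLinearMap _ ℂ ℂ ∘ₗ LinearMap.mulLeft ℂ X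
  have h := hP.conjTranspose.map_eq_zero φ fun M => ?_
  · refine Matrix.trace_conjTranspose_mul_self_eq_zero_iff.mp ?_
    rw [Matrix.trace_mul_comm]
    exact h
  · have := map_tensorPower_add_smul_eq_zero φ (realPart M : Matrix (Fin 2) (Fin 2) ℂ)
      (imaginaryPart M : Matrix (Fin 2) (Fin 2) ℂ) (fun s => ?_) Complex.I
    · rwa [realPart_add_I_smul_imaginaryPart] at this
    · refine hX.trace_mul_tensorPower_hermitian hd ?_
      have h1 : star (realPart M : Matrix (Fin 2) (Fin 2) ℂ) = _ := (realPart M).2.star_eq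
      have h2 : star (imaginaryPart M : Matrix (Fin 2) (Fin 2) ℂ) = _ := (imaginaryPart M).2.star_eq
      change star _ = _
      rw [star_add, star_smul, h1, h2]
      simp

/-! ### Symmetric binary forms -/

/-- The function `(λ₀ + λ₁)^{n-2j} (λ₀ - λ₁)^{2j}`. -/
def evenForm (n j : ℕ) (l : Fin 2 → ℂ) : ℂ :=
  (l 0 + l 1) ^ (n - 2 * j) * (l 0 - l 1) ^ (2 * j)

/-- The span of the functions `(λ₀ + λ₁)^{n-2j} (λ₀ - λ₁)^{2j}` with `2j ≤ k` and `2j ≤ n`. -/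
def evenForms (n k : ℕ) : Submodule ℂ ((Fin 2 → ℂ) → ℂ) :=
  Submodule.span ℂ {f | ∃ j, 2 * j ≤ k ∧ 2 * j ≤ n ∧ f = evenForm n j}

theorem evenForms_mono (n : ℕ) {k k' : ℕ} (h : k ≤ k') : evenForms n k ≤ evenForms n k' :=
  Submodule.span_mono fun _ ⟨j, hj, hn, hf⟩ => ⟨j, hj.trans h, hn, hf⟩

theorem add_pow_mul_mem_evenForms {m k : ℕ} (d : ℕ) {f : (Fin 2 → ℂ) → ℂ}
    (hf : f ∈ evenForms m k) : (fun l => (l 0 + l 1) ^ d * f l) ∈ evenForms (m + d) k := by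
  induction hf using Submodule.span_induction with
  | mem f h =>
    obtain ⟨j, hj, hm, rfl⟩ := h
    refine Submodule.subset_span ⟨j, hj, by omega, ?_⟩
    funext l
    rw [evenForm, evenForm, ← mul_assoc, ← pow_add]
    congr 2
    omega
  | zero =>
    convert (evenForms (m + d) k).zero_mem using 1
    funext l
    simp
  | add f g _ _ hf hg =>
    convert (evenForms (m + d) k).add_mem hf hg using 1
    funext l
    simp [mul_add]
  | smul c f _ hf =>
    convert (evenForms (m + d) k).smul_mem c hf using 1
    funext l
    simp [mul_left_comm]

theorem sub_sq_mul_mem_evenForms {m k : ℕ} {f : (Fin 2 → ℂ) → ℂ}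
    (hf : f ∈ evenForms m k) :
    (fun l => (l 0 - l 1) ^ 2 * f l) ∈ evenForms (m + 2) (k + 2) := by
  induction hf using Submodule.span_induction with
  | mem f h =>
    obtain ⟨j, hj, hm, rfl⟩ := h
    refine Submodule.subset_span ⟨j + 1, by omega, by omega, ?_⟩
    funext l
    rw [evenForm, evenForm, show m + 2 - 2 * (j + 1) = m - 2 * j by omega]
    ring
  | zero =>
    convert (evenForms (m + 2) (k + 2)).zero_mem using 1
    funext l
    simp
  | add f g _ _ hf hg =>
    convert (evenForms (m + 2) (k + 2)).add_mem hf hg using 1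
    funext l
    simp [mul_add]
  | smul c f _ hf =>
    convert (evenForms (m + 2) (k + 2)).smul_mem c hf using 1
    funext l
    simp [mul_left_comm]

/-- `4 λ₀ λ₁ = (λ₀+λ₁)² - (λ₀-λ₁)²`. -/
theorem mul_mul_mem_evenForms {m : ℕ} {f : (Fin 2 → ℂ) → ℂ} (hf : f ∈ evenForms m m) :
    (fun l => l 0 * l 1 * f l) ∈ evenForms (m + 2) (m + 2) := by
  have h1 := evenForms_mono _ (Nat.le_add_right m 2) (add_pow_mul_mem_evenForms 2 hf)
  have h2 := sub_sq_mul_mem_evenForms hf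
  convert (evenForms (m + 2) (m + 2)).smul_mem (1 / 4 : ℂ)
    ((evenForms (m + 2) (m + 2)).sub_mem h1 h2) using 1
  funext l
  simp only [Pi.smul_apply, Pi.sub_apply, smul_eq_mul]
  ring

/-- Power sums come from Newton's recursion `p_{a+2} = (λ₀+λ₁) p_{a+1} - λ₀λ₁ p_a`; the general case
strips off factors `λ₀λ₁`. -/
theorem pow_mul_pow_add_mem_evenForms (a b : ℕ) :
    (fun l : Fin 2 → ℂ => l 0 ^ a * l 1 ^ b + l 0 ^ b * l 1 ^ a) ∈
      evenForms (a + b) (a + b) := by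
  have hpow : ∀ a : ℕ, (fun l : Fin 2 → ℂ => l 0 ^ a + l 1 ^ a) ∈ evenForms a a := by
    intro a
    induction a using Nat.twoStepInduction with
    | zero =>
      have : (evenForm 0 0) ∈ evenForms 0 0 := Submodule.subset_span ⟨0, le_rfl, le_rfl, rfl⟩
      convert (evenForms 0 0).smul_mem 2 this using 1
      funext l
      simp [evenForm]
      norm_num
    | one =>
      refine Submodule.subset_span ⟨0, by omega, by omega, ?_⟩
      funext l
      simp [evenForm]
    | more a h0 h1 =>
      have h2 := evenForms_mono _ (Nat.le_succ (a + 1)) (add_pow_mul_mem_evenForms 1 h1)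
      convert (evenForms (a + 2) (a + 2)).sub_mem h2 (mul_mul_mem_evenForms h0) using 1
      funext l
      simp only [Pi.sub_apply]
      ring
  induction a generalizing b with
  | zero => simpa [add_comm] using hpow b
  | succ a ih =>
    cases b with
    | zero => simpa using hpow (a + 1)
    | succ b =>
      have := mul_mul_mem_evenForms (ih b)
      rw [show a + 1 + (b + 1) = a + b + 2 by omega]
      convert this using 1
      funext l
      ring

theorem prod_add_prod_mem_evenForms {ι : Type*} [Fintype ι] (y : ι → Fin 2) :
    (fun l : Fin 2 → ℂ => ∏ i, l (y i) + ∏ i, l (Equiv.swap 0 1 (y i))) ∈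
      evenForms (Fintype.card ι) (Fintype.card ι) := by
  have h1 : ∀ l : Fin 2 → ℂ, ∏ i, l (y i) =
      l 0 ^ (Finset.univ.filter fun i => y i = 0).card *
        l 1 ^ (Finset.univ.filter fun i => ¬ y i = 0).card := by
    intro l
    rw [← Finset.prod_filter_mul_prod_filter_not Finset.univ (fun i => y i = 0),
      Finset.prod_eq_pow_card (b := l 0), Finset.prod_eq_pow_card (b := l 1)]
    · intro i hi
      rw [show y i = 1 by have := (Finset.mem_filter.mp hi).2; omega]
    · intro i hi
      rw [(Finset.mem_filter.mp hi).2]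
  have h2 : ∀ l : Fin 2 → ℂ, ∏ i, l (Equiv.swap 0 1 (y i)) =
      l 0 ^ (Finset.univ.filter fun i => ¬ y i = 0).card *
        l 1 ^ (Finset.univ.filter fun i => y i = 0).card := by
    intro l
    have := h1 (l ∘ Equiv.swap 0 1)
    simp only [Function.comp_apply, Equiv.swap_apply_left, Equiv.swap_apply_right] at this
    rw [this, mul_comm]
  have hcard : Fintype.card ι = (Finset.univ.filter fun i => y i = 0).card +
      (Finset.univ.filter fun i => ¬ y i = 0).card :=
    (Finset.card_filter_add_card_filter_not _).symm
  simp only [h1, h2]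
  rw [hcard]
  exact pow_mul_pow_add_mem_evenForms _ _

/-! ### Trace forms of local invariant operators -/

theorem IsRotInvariant.diagTrace_comp_swap {n : ℕ} {X : Operator n} (hX : IsRotInvariant X)
    (l : Fin 2 → ℂ) : diagTrace n X (l ∘ Equiv.swap 0 1) = diagTrace n X l := by
  -- `N` has determinant `-1`, so invariance under SU(2) alone does not apply directly;
  -- `commute_tensorPower` does.
  let N : Matrix (Fin 2) (Fin 2) ℂ := !![0, 1; 1, 0]
  have hN : N * N = 1 := by
    ext i j; fin_cases i <;> fin_cases j <;> simp [N]
  have hl : Matrix.diagonal (l ∘ Equiv.swap 0 1) = N * Matrix.diagonal l * N := by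
    ext i j; fin_cases i <;> fin_cases j <;> simp [N, Matrix.mul_apply, Matrix.vecMul_diagonal, Fin.sum_univ_two]
  rw [diagTrace_apply, hl, tensorPower_mul, tensorPower_mul, ← mul_assoc, Matrix.trace_mul_comm,
    ← mul_assoc, ← mul_assoc, ← (hX.commute_tensorPower N).eq, mul_assoc X, ← tensorPower_mul, hN,
    tensorPower_one, mul_one, diagTrace_apply]

theorem tensorPower_diagonal (n : ℕ) (l : Fin 2 → ℂ) :
    tensorPower n (Matrix.diagonal l) = Matrix.diagonal fun x => ∏ i, l (x i) := by
  ext x y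
  simp only [tensorPower, Matrix.of_apply, Matrix.diagonal_apply]
  by_cases h : x = y
  · simp [h]
  · rw [if_neg h]
    obtain ⟨i, hi⟩ := Function.ne_iff.mp h
    exact Finset.prod_eq_zero (Finset.mem_univ i) (if_neg hi)

theorem diagTrace_eq_sum {n : ℕ} (X : Operator n) (l : Fin 2 → ℂ) :
    diagTrace n X l = ∑ x, X x x * ∏ i, l (x i) := by
  rw [diagTrace_apply, tensorPower_diagonal]
  simp [Matrix.trace, Matrix.mul_diagonal]

theorem ActsOn.exists_diagTrace_eq {n : ℕ} {S : Finset (Fin n)} {X : Operator n}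
    (hX : ActsOn S X) : ∃ b : (S → Fin 2) → ℂ, ∀ l, diagTrace n X l =
      (l 0 + l 1) ^ (n - S.card) * ∑ y, b y * ∏ i, l (y i) := by
  obtain ⟨B, hB⟩ := hX
  refine ⟨fun y => B y y, fun l => ?_⟩
  rw [diagTrace_eq_sum]
  let e := Equiv.piEquivPiSubtypeProd (fun i => i ∈ S) (fun _ : Fin n => Fin 2)
  have h : ∀ x : Fin n → Fin 2, X x x * ∏ i, l (x i) =
      (B (e x).1 (e x).1 * ∏ i, l ((e x).1 i)) * ∏ i, l ((e x).2 i) := by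
    intro x
    rw [hB, if_pos fun _ _ => rfl, mul_assoc,
      ← Fintype.prod_subtype_mul_prod_subtype (fun i => i ∈ S)]
    simp only [e, Equiv.piEquivPiSubtypeProd_apply]
    congr!
  have hc : Fintype.card {i // i ∉ S} = n - S.card := by
    rw [Fintype.card_subtype_compl, Fintype.card_fin, Fintype.card_coe]
  rw [Fintype.sum_congr _ _ h, e.sum_comp fun p : (S → Fin 2) × ({i // i ∉ S} → Fin 2) =>
    (B p.1 p.1 * ∏ i, l (p.1 i)) * ∏ i, l (p.2 i), Fintype.sum_prod_type]
  have h2 : ∑ z : {i // i ∉ S} → Fin 2, ∏ i, l (z i) = (l 0 + l 1) ^ (n - S.card) := by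
    rw [← hc, ← Fin.sum_univ_two, ← Finset.card_univ, ← Finset.prod_const, Finset.prod_univ_sum,
      Fintype.piFinset_univ]
  simp only [← Finset.mul_sum, h2, ← Finset.sum_mul]
  rw [mul_comm]

/-- Averaging over `λ₀ ↔ λ₁` turns the form on the qubits of `S` into a sum of symmetrized
monomials. -/
theorem IsRotInvariant.diagTrace_mem_of_actsOn {n : ℕ} {S : Finset (Fin n)} {X : Operator n}
    (hX : IsRotInvariant X) (hS : ActsOn S X) : diagTrace n X ∈ evenForms n S.card := by
  obtain ⟨b, hb⟩ := hS.exists_diagTrace_eq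
  have h : diagTrace n X = ∑ y, (b y / 2) • fun l : Fin 2 → ℂ => (l 0 + l 1) ^ (n - S.card) *
      (∏ i, l (y i) + ∏ i, l (Equiv.swap 0 1 (y i))) := by
    funext l
    have h1 := hb l
    have h2 := hb (l ∘ Equiv.swap 0 1)
    rw [hX.diagTrace_comp_swap] at h2
    simp only [Function.comp_apply, Equiv.swap_apply_left, Equiv.swap_apply_right] at h2
    have h3 : diagTrace n X l = (1 / 2) * (diagTrace n X l + diagTrace n X l) := by ring
    rw [h3]
    nth_rw 1 [h1]
    rw [h2]
    simp only [Finset.sum_apply, Pi.smul_apply, smul_eq_mul, Finset.mul_sum,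
      ← Finset.sum_add_distrib]
    refine Finset.sum_congr rfl fun y _ => ?_
    ring
  rw [h]
  refine Submodule.sum_mem _ fun y _ => Submodule.smul_mem _ _ ?_
  have hc : S.card ≤ n := by simpa using S.card_le_univ
  have := add_pow_mul_mem_evenForms (n - S.card) (prod_add_prod_mem_evenForms y)
  rwa [Fintype.card_coe, Nat.add_sub_cancel' hc] at this

theorem diagTrace_lie {n : ℕ} {X : Operator n} (hX : IsRotInvariant X) (Y : Operator n) :
    diagTrace n ⁅X, Y⁆ = 0 := by
  funext l
  rw [diagTrace_apply, Ring.lie_def, sub_mul, Matrix.trace_sub, mul_assoc Y,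
    (hX.commute_tensorPower _).eq, ← mul_assoc Y, Matrix.trace_mul_comm (Y * _) X, ← mul_assoc,
    sub_self, Pi.zero_apply]

/-! ### Invariants inherited by the generated Lie algebra -/

theorem IsRotInvariant.add {n : ℕ} {X Y : Operator n} (hX : IsRotInvariant X)
    (hY : IsRotInvariant Y) : IsRotInvariant (X + Y) :=
  fun U hU => (hX U hU).add_left (hY U hU)

theorem IsRotInvariant.mul {n : ℕ} {X Y : Operator n} (hX : IsRotInvariant X)
    (hY : IsRotInvariant Y) : IsRotInvariant (X * Y) :=
  fun U hU => (hX U hU).mul_left (hY U hU)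

theorem IsRotInvariant.smul {n : ℕ} {X : Operator n} (hX : IsRotInvariant X) (c : ℂ) :
    IsRotInvariant (c • X) :=
  fun U hU => (hX U hU).smul_left c

theorem IsRotInvariant.sub {n : ℕ} {X Y : Operator n} (hX : IsRotInvariant X)
    (hY : IsRotInvariant Y) : IsRotInvariant (X - Y) :=
  fun U hU => (hX U hU).sub_left (hY U hU)

theorem isRotInvariant_zero {n : ℕ} : IsRotInvariant (0 : Operator n) :=
  fun _ _ => Commute.zero_left _

theorem isRotInvariant_one {n : ℕ} : IsRotInvariant (1 : Operator n) :=
  fun _ _ => Commute.one_left _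

theorem IsRotInvariant.sum {n : ℕ} {ι : Type*} {s : Finset ι} {X : ι → Operator n}
    (h : ∀ i ∈ s, IsRotInvariant (X i)) : IsRotInvariant (∑ i ∈ s, X i) :=
  fun U hU => Commute.sum_left s X _ fun i hi => h i hi U hU

theorem mem_localLieAlgebra_properties {n k : ℕ} {A : Operator n}
    (hA : A ∈ localLieAlgebra n k) :
    IsRotInvariant A ∧ A + Aᴴ = 0 ∧ diagTrace n A ∈ evenForms n k := by
  refine LieSubalgebra.lieSpan_induction (R := ℝ)
    (p := fun A _ => IsRotInvariant A ∧ A + Aᴴ = 0 ∧ diagTrace n A ∈ evenForms n k)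
    ?_ ?_ ?_ ?_ ?_ hA
  · rintro X ⟨h1, ⟨S, hS, h2⟩, h3⟩
    exact ⟨h3, h1, evenForms_mono n hS (h3.diagTrace_mem_of_actsOn h2)⟩
  · exact ⟨isRotInvariant_zero, by simp, by simp⟩
  · rintro X Y _ _ ⟨h1, h2, h3⟩ ⟨h4, h5, h6⟩
    refine ⟨h1.add h4, ?_, ?_⟩
    · rw [Matrix.conjTranspose_add, add_add_add_comm, h2, h5, add_zero]
    · rw [map_add]
      exact Submodule.add_mem _ h3 h6
  · rintro c X _ ⟨h1, h2, h3⟩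
    rw [← Complex.coe_smul]
    refine ⟨h1.smul _, ?_, ?_⟩
    · rw [Matrix.conjTranspose_smul, Complex.star_def, Complex.conj_ofReal, ← smul_add, h2,
        smul_zero]
    · rw [map_smul]
      exact Submodule.smul_mem _ _ h3
  · rintro X Y _ _ ⟨h1, h2, _⟩ ⟨h3, h4, _⟩
    refine ⟨(h1.mul h3).sub (h3.mul h1), ?_, ?_⟩
    · rw [Ring.lie_def, Matrix.conjTranspose_sub, Matrix.conjTranspose_mul,
        Matrix.conjTranspose_mul, eq_neg_of_add_eq_zero_right h2, eq_neg_of_add_eq_zero_right h4]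
      noncomm_ring
    · rw [diagTrace_lie h1]
      exact Submodule.zero_mem _

/-! ### Exchange interactions and qubit swaps -/

theorem onQubit_eq_tensorFamily {n : ℕ} (r : Fin n) (M : Matrix (Fin 2) (Fin 2) ℂ) :
    onQubit r M = tensorFamily (Function.update (fun _ => 1) r M) := by
  ext x y
  simp only [onQubit, tensorFamily, Matrix.of_apply]
  split_ifs with h
  · rw [Finset.prod_eq_single_of_mem r (Finset.mem_univ r)]
    · simp
    · intro i _ hi
      simp [Function.update_of_ne hi, h i hi]
  · push Not at h
    obtain ⟨i, hi, hxy⟩ := h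
    refine (Finset.prod_eq_zero (Finset.mem_univ i) ?_).symm
    simp [Function.update_of_ne hi, hxy]

/-- The family equal to `M` at the qubits `r` and `s`, and to the identity elsewhere. -/
def pairFamily {n : ℕ} (r s : Fin n) (M : Matrix (Fin 2) (Fin 2) ℂ) (i : Fin n) :
    Matrix (Fin 2) (Fin 2) ℂ :=
  if i = r ∨ i = s then M else 1

theorem exchange_eq_sum {n : ℕ} {r s : Fin n} (h : r ≠ s) :
    exchange r s = ∑ v, (1 / 2 : ℂ) • tensorFamily (pairFamily r s (pauli v)) := by
  rw [exchange, Finset.smul_sum]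
  refine Finset.sum_congr rfl fun v _ => ?_
  rw [onQubit_eq_tensorFamily, onQubit_eq_tensorFamily, tensorFamily_mul]
  congr 2
  funext i
  by_cases h1 : i = r
  · subst h1; simp [pairFamily, h]
  · by_cases h2 : i = s
    · subst h2; simp [pairFamily, h1]
    · simp [pairFamily, h1, h2]

theorem pauli_conjTranspose (v : Fin 3) : (pauli v)ᴴ = pauli v := by
  fin_cases v <;> ext i j <;> fin_cases i <;> fin_cases j <;>
    simp [pauli, Matrix.conjTranspose_apply]

/-- Entrywise form of the identity expressing the two-qubit swap as `½(1 + ∑ σ⊗σ)`. -/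
theorem sum_pauli_mul_pauli (a b c d : Fin 2) :
    (1 / 2 : ℂ) * ∑ v, pauli v a b * pauli v c d +
        1 / 2 * ((if a = b then 1 else 0) * if c = d then 1 else 0) =
      (if a = d then 1 else 0) * if c = b then 1 else 0 := by
  fin_cases a <;> fin_cases b <;> fin_cases c <;> fin_cases d <;>
    simp [pauli, Fin.sum_univ_three] <;> norm_num

theorem sum_trace_pauli_mul_diagonal_sq (l : Fin 2 → ℂ) :
    ∑ v, (pauli v * Matrix.diagonal l).trace ^ 2 = (l 0 - l 1) ^ 2 := by
  simp [pauli, Fin.sum_univ_three, Matrix.trace, Fin.sum_univ_two, Matrix.mul_diagonal]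
  ring

theorem tensorFamily_pairFamily_apply {n : ℕ} {r s : Fin n} (h : r ≠ s)
    (M : Matrix (Fin 2) (Fin 2) ℂ) (x y : Fin n → Fin 2) :
    tensorFamily (pairFamily r s M) x y =
      if ∀ i, i ≠ r → i ≠ s → x i = y i then M (x r) (y r) * M (x s) (y s) else 0 := by
  simp only [tensorFamily, Matrix.of_apply]
  split_ifs with hxy
  · rw [Finset.prod_eq_mul_of_mem r s (Finset.mem_univ r) (Finset.mem_univ s) h]
    · simp [pairFamily]
    · rintro i _ ⟨hr, hs⟩
      rw [pairFamily, if_neg (by simp [hr, hs]), hxy i hr hs, Matrix.one_apply_eq]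
  · push Not at hxy
    obtain ⟨i, hr, hs, hne⟩ := hxy
    exact Finset.prod_eq_zero (Finset.mem_univ i) (by simp [pairFamily, hr, hs, hne])

/-- The operator exchanging the qubits `r` and `s`. -/
def swapOperator {n : ℕ} (r s : Fin n) : Operator n :=
  Matrix.of fun x y => if x = y ∘ Equiv.swap r s then 1 else 0

theorem exchange_eq_swapOperator_sub {n : ℕ} {r s : Fin n} (h : r ≠ s) :
    exchange r s = swapOperator r s - (1 / 2 : ℂ) • 1 := by
  rw [eq_sub_iff_add_eq, exchange_eq_sum h, ← Finset.smul_sum]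
  ext x y
  have h1 : x = y ↔ (∀ i, i ≠ r → i ≠ s → x i = y i) ∧ x r = y r ∧ x s = y s := by
    refine ⟨by rintro rfl; simp, fun ⟨h1, h2, h3⟩ => funext fun i => ?_⟩
    by_cases hr : i = r
    · rw [hr, h2]
    · by_cases hs : i = s
      · rw [hs, h3]
      · exact h1 i hr hs
  have h2 : x = y ∘ Equiv.swap r s ↔
      (∀ i, i ≠ r → i ≠ s → x i = y i) ∧ x r = y s ∧ x s = y r := by
    refine ⟨?_, fun ⟨h1, h2, h3⟩ => funext fun i => ?_⟩
    · rintro rfl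
      refine ⟨fun i hr hs => ?_, ?_, ?_⟩ <;> simp [*, Equiv.swap_apply_of_ne_of_ne]
    · by_cases hr : i = r
      · simp [hr, h2]
      · by_cases hs : i = s
        · simp [hs, h3]
        · simp [Equiv.swap_apply_of_ne_of_ne hr hs, h1 i hr hs]
  simp only [Matrix.add_apply, Matrix.smul_apply, Matrix.sum_apply, smul_eq_mul,
    tensorFamily_pairFamily_apply h, Matrix.one_apply, swapOperator, Matrix.of_apply, h1, h2]
  by_cases hxy : ∀ i, i ≠ r → i ≠ s → x i = y i
  · have := sum_pauli_mul_pauli (x r) (y r) (x s) (y s)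
    simp only [ite_zero_mul_ite_zero, mul_one] at this
    simpa only [if_pos hxy, and_iff_right hxy] using this
  · simp only [hxy, false_and, if_false, Finset.sum_const_zero, mul_zero, add_zero]

theorem swapOperator_mul_apply {n : ℕ} (r s : Fin n) (D : Operator n) (x y : Fin n → Fin 2) :
    (swapOperator r s * D) x y = D (x ∘ Equiv.swap r s) y := by
  have h : ∀ z : Fin n → Fin 2, x = z ∘ Equiv.swap r s ↔ x ∘ Equiv.swap r s = z := by
    intro z
    rw [← Equiv.symm_swap, Equiv.eq_comp_symm, Equiv.symm_swap]
  simp [swapOperator, Matrix.mul_apply, h]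

theorem mul_swapOperator_apply {n : ℕ} (r s : Fin n) (D : Operator n) (x y : Fin n → Fin 2) :
    (D * swapOperator r s) x y = D x (y ∘ Equiv.swap r s) := by
  simp [swapOperator, Matrix.mul_apply]

theorem commute_swapOperator_iff {n : ℕ} (r s : Fin n) (D : Operator n) :
    Commute (swapOperator r s) D ↔ ∀ x y : Fin n → Fin 2,
      D (x ∘ Equiv.swap r s) (y ∘ Equiv.swap r s) = D x y := by
  have hss : ∀ y : Fin n → Fin 2, (y ∘ Equiv.swap r s) ∘ Equiv.swap r s = y := by
    intro y
    funext i
    simp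
  constructor
  · intro h x y
    have := congrFun (congrFun h.eq x) (y ∘ Equiv.swap r s)
    rwa [swapOperator_mul_apply, mul_swapOperator_apply, hss] at this
  · intro h
    ext x y
    rw [swapOperator_mul_apply, mul_swapOperator_apply, ← h x, hss]

theorem isPermInvariant_of_commute_swapOperator {n : ℕ} {D : Operator n}
    (h : ∀ r s : Fin n, r ≠ s → Commute (swapOperator r s) D) : IsPermInvariant D := by
  intro σ
  induction σ using Equiv.Perm.swap_induction_on with
  | one => intro x y; rfl
  | swap_mul f r s hrs ih =>
    intro x y
    rw [← (commute_swapOperator_iff r s D).mp (h r s hrs) x y, 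
      ← ih (x ∘ Equiv.swap r s)]
    rfl

theorem isRotInvariant_exchange {n : ℕ} {r s : Fin n} (h : r ≠ s) :
    IsRotInvariant (exchange r s) := by
  rw [exchange_eq_swapOperator_sub h]
  refine IsRotInvariant.sub (fun U _ => ?_) (isRotInvariant_one.smul _)
  rw [commute_swapOperator_iff]
  intro x y
  simp only [tensorPower, Matrix.of_apply, Function.comp_apply]
  exact Equiv.prod_comp (Equiv.swap r s) fun i => U (x i) (y i)

/-! ### Pauli expansion and trace form of `C_l` -/

/-- The product `R_{i₁i₂} ⋯ R_{i_{l-1}i_l}`. -/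
noncomputable def exchangeProd {n l : ℕ} (i : Fin l ↪ Fin n) : Operator n :=
  (List.ofFn fun a : Fin (l / 2) =>
    exchange (i ⟨2 * a.val, by omega⟩) (i ⟨2 * a.val + 1, by omega⟩)).prod

theorem opC_eq (n l : ℕ) :
    opC n l = (1 / ((l / 2).factorial : ℂ)) • ∑ i : Fin l ↪ Fin n, exchangeProd i := rfl

theorem isRotInvariant_exchangeProd {n l : ℕ} (i : Fin l ↪ Fin n) :
    IsRotInvariant (exchangeProd i) := by
  intro U hU
  refine Commute.list_prod_left _ _ fun X hX => ?_
  obtain ⟨a, rfl⟩ := List.mem_ofFn.mp hX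
  refine isRotInvariant_exchange ?_ U hU
  simp [i.injective.eq_iff]

theorem list_prod_ofFn_eq_single {M : Type*} [Monoid M] {m : ℕ} (g : Fin m → M) (a : Fin m)
    (h : ∀ b, b ≠ a → g b = 1) : (List.ofFn g).prod = g a := by
  induction m with
  | zero => exact a.elim0
  | succ m ih =>
    rw [List.ofFn_succ, List.prod_cons]
    cases a using Fin.cases with
    | zero =>
      rw [List.prod_eq_one, mul_one]
      intro x hx
      obtain ⟨b, rfl⟩ := List.mem_ofFn.mp hx
      exact h _ (Fin.succ_ne_zero b)
    | succ a =>
      rw [h 0 (Fin.succ_ne_zero a).symm, one_mul]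
      exact ih _ a fun b hb => h _ fun hs => hb (Fin.succ_injective _ hs)

/-- The tensor factors of the Pauli strings in the expansion of `R_{i₁i₂} ⋯ R_{i_{l-1}i_l}`. -/
noncomputable def pauliString {n l : ℕ} (i : Fin l ↪ Fin n) (f : Fin (l / 2) → Fin 3) (r : Fin n) :
    Matrix (Fin 2) (Fin 2) ℂ :=
  (List.ofFn fun a : Fin (l / 2) =>
    pairFamily (i ⟨2 * a.val, by omega⟩) (i ⟨2 * a.val + 1, by omega⟩) (pauli (f a)) r).prod

theorem list_prod_tensorFamily {n m : ℕ} (N : Fin m → Fin n → Matrix (Fin 2) (Fin 2) ℂ) :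
    (List.ofFn fun a => tensorFamily (N a)).prod =
      tensorFamily fun r => (List.ofFn fun a => N a r).prod := by
  induction m with
  | zero => simpa using tensorFamily_one.symm
  | succ m ih => simp [List.ofFn_succ, ih, tensorFamily_mul]

theorem exchangeProd_eq_sum {n l : ℕ} (i : Fin l ↪ Fin n) :
    exchangeProd i = (1 / 2 : ℂ) ^ (l / 2) • ∑ f, tensorFamily (pauliString i f) := by
  have h : ∀ a : Fin (l / 2), exchange (i ⟨2 * a.val, by omega⟩) (i ⟨2 * a.val + 1, by omega⟩) =
      ∑ v, (1 / 2 : ℂ) • tensorFamily (pairFamily (i ⟨2 * a.val, by omega⟩)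
        (i ⟨2 * a.val + 1, by omega⟩) (pauli v)) :=
    fun a => exchange_eq_sum (by simp [i.injective.eq_iff])
  rw [exchangeProd]
  simp only [h]
  -- The ordered product is multilinear in its factors, so a noncommutative product of sums expands
  -- over choices `f`.
  rw [← MultilinearMap.mkPiAlgebraFin_apply (R := ℂ), MultilinearMap.map_sum, Finset.smul_sum]
  refine Finset.sum_congr rfl fun f _ => ?_
  rw [MultilinearMap.map_smul_univ, MultilinearMap.mkPiAlgebraFin_apply, Finset.prod_const,
    Finset.card_univ, Fintype.card_fin, list_prod_tensorFamily]
  rfl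

theorem pauliString_apply {n l : ℕ} (i : Fin l ↪ Fin n) (f : Fin (l / 2) → Fin 3)
    (b : Fin l) (a : Fin (l / 2)) (hab : b.val / 2 = a.val) :
    pauliString i f (i b) = pauli (f a) := by
  rw [pauliString, list_prod_ofFn_eq_single _ a]
  · rw [pairFamily, if_pos]
    simp only [i.injective.eq_iff, Fin.ext_iff]
    omega
  · intro c hc
    rw [pairFamily, if_neg]
    simp only [i.injective.eq_iff, Fin.ext_iff] at hc ⊢
    omega

theorem pauliString_of_notMem {n l : ℕ} (i : Fin l ↪ Fin n) (f : Fin (l / 2) → Fin 3)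
    {r : Fin n} (hr : ∀ b, i b ≠ r) : pauliString i f r = 1 := by
  refine List.prod_eq_one fun x hx => ?_
  obtain ⟨a, rfl⟩ := List.mem_ofFn.mp hx
  rw [pairFamily, if_neg]
  rintro (h | h) <;> exact hr _ h.symm

theorem conjTranspose_pauliString {n l : ℕ} (hl : Even l) (i : Fin l ↪ Fin n)
    (f : Fin (l / 2) → Fin 3) (r : Fin n) : (pauliString i f r)ᴴ = pauliString i f r := by
  by_cases hr : ∃ b, i b = r
  · obtain ⟨b, rfl⟩ := hr
    obtain ⟨m, hm⟩ := hl
    rw [pauliString_apply i f b ⟨b / 2, by omega⟩ rfl, pauli_conjTranspose]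
  · push Not at hr
    rw [pauliString_of_notMem i f hr, Matrix.conjTranspose_one]

theorem conjTranspose_exchangeProd {n l : ℕ} (hl : Even l) (i : Fin l ↪ Fin n) :
    (exchangeProd i)ᴴ = exchangeProd i := by
  rw [exchangeProd_eq_sum, Matrix.conjTranspose_smul, Matrix.conjTranspose_sum]
  simp only [conjTranspose_tensorFamily, conjTranspose_pauliString hl]
  simp

theorem actsOn_tensorFamily {n : ℕ} {S : Finset (Fin n)}
    {N : Fin n → Matrix (Fin 2) (Fin 2) ℂ} (h : ∀ r ∉ S, N r = 1) :
    ActsOn S (tensorFamily N) := by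
  refine ⟨Matrix.of fun x y => ∏ r : S, N r (x r) (y r), fun x y => ?_⟩
  simp only [tensorFamily, Matrix.of_apply]
  split_ifs with hxy
  · rw [Finset.prod_coe_sort S fun r => N r (x r) (y r)]
    refine (Finset.prod_subset (Finset.subset_univ S) fun r _ hr => ?_).symm
    rw [h r hr, hxy r hr, Matrix.one_apply_eq]
  · push Not at hxy
    obtain ⟨r, hr, hne⟩ := hxy
    refine Finset.prod_eq_zero (Finset.mem_univ r) ?_
    rw [h r hr, Matrix.one_apply_ne hne]

theorem ActsOn.smul {n : ℕ} {S : Finset (Fin n)} {A : Operator n} (hA : ActsOn S A) (c : ℂ) :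
    ActsOn S (c • A) := by
  obtain ⟨B, hB⟩ := hA
  refine ⟨c • B, fun x y => ?_⟩
  simp [hB x y]

theorem ActsOn.sum {n : ℕ} {S : Finset (Fin n)} {ι : Type*} {s : Finset ι} {A : ι → Operator n}
    (hA : ∀ i, ActsOn S (A i)) : ActsOn S (∑ i ∈ s, A i) := by
  choose B hB using hA
  refine ⟨∑ i ∈ s, B i, fun x y => ?_⟩
  simp only [Matrix.sum_apply, hB]
  split_ifs <;> simp

theorem isLocal_exchangeProd {n l : ℕ} (i : Fin l ↪ Fin n) : IsLocal l (exchangeProd i) := by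
  refine ⟨Finset.univ.map i, by simp, ?_⟩
  rw [exchangeProd_eq_sum]
  refine (ActsOn.sum fun f => actsOn_tensorFamily fun r hr => ?_).smul _
  exact pauliString_of_notMem i f (by simpa using hr)

/-- Each pair contributes `½ ∑ᵥ tr(σᵥ diag(λ))² = ½(λ₀-λ₁)²` and each free qubit `λ₀+λ₁`. Evenness
of `l` makes the pairs exhaust the range of `i`. -/
theorem diagTrace_exchangeProd {n l : ℕ} (hl : Even l) (i : Fin l ↪ Fin n) :
    diagTrace n (exchangeProd i) = (1 / 2 : ℂ) ^ (l / 2) • evenForm n (l / 2) := by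
  funext d
  have h2 : l / 2 * 2 = l := Nat.div_two_mul_two_of_even hl
  let e : Fin (l / 2) × Fin 2 ≃ Fin l := finProdFinEquiv.trans (finCongr h2)
  have key : ∀ f : Fin (l / 2) → Fin 3,
      (tensorFamily (pauliString i f) * tensorPower n (Matrix.diagonal d)).trace =
        (∏ a, (pauli (f a) * Matrix.diagonal d).trace ^ 2) * (d 0 + d 1) ^ (n - l) := by
    intro f
    rw [tensorPower_eq_tensorFamily, tensorFamily_mul, trace_tensorFamily,
      ← Finset.prod_mul_prod_compl (Finset.univ.map i)]
    congr 1
    · rw [Finset.prod_map, ← e.prod_comp, Fintype.prod_prod_type]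
      refine Finset.prod_congr rfl fun a _ => ?_
      rw [Fin.prod_univ_two, pauliString_apply i f _ a, pauliString_apply i f _ a, sq]
      · simp [e]; omega
      · simp [e]
    · have hc : ((Finset.univ.map i)ᶜ).card = n - l := by simp [Finset.card_compl]
      rw [← hc, Finset.prod_eq_pow_card]
      intro r hr
      rw [pauliString_of_notMem i f (by simpa using hr), one_mul, Matrix.trace_fin_two]
      simp
  rw [exchangeProd_eq_sum, diagTrace_apply, Matrix.smul_mul, Matrix.trace_smul, Finset.sum_mul,
    Matrix.trace_sum]
  simp only [key, ← Finset.sum_mul]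
  have hp := Finset.prod_univ_sum (fun _ : Fin (l / 2) => (Finset.univ : Finset (Fin 3)))
    fun _ v => (pauli v * Matrix.diagonal d).trace ^ 2
  rw [Fintype.piFinset_univ] at hp
  rw [← hp]
  simp only [sum_trace_pauli_mul_diagonal_sq, Finset.prod_const, Finset.card_univ,
    Fintype.card_fin, Pi.smul_apply, evenForm, mul_comm 2 (l / 2), h2, ← pow_mul]
  rw [mul_comm (_ ^ l)]

theorem diagTrace_opC {n l : ℕ} (hl : Even l) (hn : l ≤ n) :
    ∃ c : ℂ, c ≠ 0 ∧ diagTrace n (opC n l) = c • evenForm n (l / 2) := by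
  refine ⟨1 / ((l / 2).factorial : ℂ) * (n.descFactorial l * (1 / 2 : ℂ) ^ (l / 2)), ?_, ?_⟩
  · have h1 : ((l / 2).factorial : ℂ) ≠ 0 := by exact_mod_cast Nat.factorial_ne_zero _
    have h2 : (n.descFactorial l : ℂ) ≠ 0 := by
      exact_mod_cast (Nat.descFactorial_pos.mpr hn).ne'
    exact mul_ne_zero (one_div_ne_zero h1) (mul_ne_zero h2 (pow_ne_zero _ (by norm_num)))
  · rw [opC_eq, map_smul, map_sum]
    simp only [diagTrace_exchangeProd hl, Finset.sum_const, Finset.card_univ,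
      Fintype.card_embedding_eq, Fintype.card_fin]
    rw [← Nat.cast_smul_eq_nsmul ℂ, smul_smul, smul_smul, mul_assoc]

theorem conjTranspose_opC {n l : ℕ} (hl : Even l) : (opC n l)ᴴ = opC n l := by
  rw [opC_eq, Matrix.conjTranspose_smul, Matrix.conjTranspose_sum]
  simp only [conjTranspose_exchangeProd hl]
  simp

theorem isRotInvariant_opC (n l : ℕ) : IsRotInvariant (opC n l) :=
  (IsRotInvariant.sum fun i _ => isRotInvariant_exchangeProd i).smul _

/-! ### Permutation invariance of `C_l` -/

/-- Conjugation by a permutation of the qubits. -/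
def permConj {n : ℕ} (σ : Equiv.Perm (Fin n)) : Operator n ≃ₐ[ℂ] Operator n :=
  Matrix.reindexAlgEquiv ℂ ℂ (σ.arrowCongr (Equiv.refl (Fin 2)))

theorem permConj_apply {n : ℕ} (σ : Equiv.Perm (Fin n)) (A : Operator n)
    (x y : Fin n → Fin 2) : permConj σ A x y = A (x ∘ σ) (y ∘ σ) := rfl

theorem permConj_onQubit {n : ℕ} (σ : Equiv.Perm (Fin n)) (r : Fin n)
    (M : Matrix (Fin 2) (Fin 2) ℂ) : permConj σ (onQubit r M) = onQubit (σ r) M := by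
  ext x y
  have h : (∀ i, i ≠ r → x (σ i) = y (σ i)) ↔ ∀ i, i ≠ σ r → x i = y i := by
    rw [← σ.forall_congr_right (q := fun i => i ≠ σ r → x i = y i)]
    simp
  simp [permConj_apply, onQubit, h]

theorem permConj_exchange {n : ℕ} (σ : Equiv.Perm (Fin n)) (r s : Fin n) :
    permConj σ (exchange r s) = exchange (σ r) (σ s) := by
  simp only [exchange, map_smul, map_sum, map_mul, permConj_onQubit]

theorem isPermInvariant_opC (n l : ℕ) : IsPermInvariant (opC n l) := by
  intro σ x y
  have h : permConj σ (opC n l) = opC n l := by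
    rw [opC_eq, map_smul, map_sum,
      ← (Equiv.embeddingCongr (Equiv.refl (Fin l)) σ).sum_comp exchangeProd]
    congr 1
    refine Finset.sum_congr rfl fun i _ => ?_
    rw [exchangeProd, map_list_prod, List.map_ofFn, exchangeProd]
    congr 2
    funext a
    exact permConj_exchange _ _ _
  exact congrFun (congrFun h x) y

/-! ### Elements of the Lie algebra -/

theorem I_smul_exchangeProd_mem {n k l : ℕ} (hl : Even l) (hk : l ≤ k) (i : Fin l ↪ Fin n) :
    Complex.I • exchangeProd i ∈ localLieAlgebra n k := by
  refine LieSubalgebra.subset_lieSpan ⟨?_, ?_, (isRotInvariant_exchangeProd i).smul _⟩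
  · rw [Matrix.conjTranspose_smul, conjTranspose_exchangeProd hl]
    simp
  · obtain ⟨S, hS, h⟩ := isLocal_exchangeProd i
    exact ⟨S, hS.trans hk, h.smul _⟩

theorem I_smul_opC_mem {n k l : ℕ} (hl : Even l) (hk : l ≤ k) :
    Complex.I • opC n l ∈ localLieAlgebra n k := by
  have h : Complex.I • opC n l =
      (1 / ((l / 2).factorial : ℝ)) • ∑ i : Fin l ↪ Fin n, Complex.I • exchangeProd i := by
    rw [opC_eq, ← Finset.smul_sum, ← Complex.coe_smul, smul_comm]
    simp
  rw [h]
  exact (localLieAlgebra n k).smul_mem _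
    (sum_mem fun i _ => I_smul_exchangeProd_mem hl hk i)

theorem exchangeProd_two {n : ℕ} (i : Fin 2 ↪ Fin n) : exchangeProd i = exchange (i 0) (i 1) := by
  simp [exchangeProd]

theorem I_smul_exchange_mem {n k : ℕ} (hk : 2 ≤ k) {r s : Fin n} (h : r ≠ s) :
    Complex.I • exchange r s ∈ localLieAlgebra n k := by
  let i : Fin 2 ↪ Fin n := ⟨![r, s], by
    intro a b hab
    fin_cases a <;> fin_cases b <;> simp_all⟩
  have := I_smul_exchangeProd_mem (k := k) even_two hk i
  rwa [exchangeProd_two] at this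

/-! ### The scalar case `k ≤ 1` -/

theorem IsRotInvariant.apply_eq_zero {n : ℕ} {X : Operator n} (hX : IsRotInvariant X)
    {x y : Fin n → Fin 2} (r : Fin n) (hr : x r ≠ y r) (h : ∀ i, i ≠ r → x i = y i) :
    X x y = 0 := by
  -- The weights of `x` and `y` under `diag(1,2)^{⊗n}` are nonzero and differ, because the words
  -- differ at `r` only; commutation then kills the entry.
  have hc := congrFun (congrFun (hX.commute_tensorPower (Matrix.diagonal ![1, 2])).eq x) y
  rw [tensorPower_diagonal, Matrix.mul_diagonal, Matrix.diagonal_mul] at hc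
  have hp : ∀ z : Fin n → Fin 2, ∏ i, (![1, 2] : Fin 2 → ℂ) (z i) =
      (![1, 2] : Fin 2 → ℂ) (z r) * ∏ i ∈ Finset.univ.erase r, (![1, 2] : Fin 2 → ℂ) (z i) :=
    fun z => (Finset.mul_prod_erase _ _ (Finset.mem_univ r)).symm
  have hxy : ∏ i ∈ Finset.univ.erase r, (![1, 2] : Fin 2 → ℂ) (x i) =
      ∏ i ∈ Finset.univ.erase r, (![1, 2] : Fin 2 → ℂ) (y i) :=
    Finset.prod_congr rfl fun i hi => by rw [h i (Finset.ne_of_mem_erase hi)]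
  have hne : ∏ i ∈ Finset.univ.erase r, (![1, 2] : Fin 2 → ℂ) (y i) ≠ 0 := by
    refine Finset.prod_ne_zero_iff.mpr fun i _ => ?_
    generalize y i = a
    fin_cases a <;> simp
  rw [hp, hp, hxy, mul_right_comm, ← mul_assoc] at hc
  have hc' := mul_right_cancel₀ hne hc
  have h3 : (![1, 2] : Fin 2 → ℂ) (y r) ≠ (![1, 2] : Fin 2 → ℂ) (x r) := by
    generalize x r = a at hr
    generalize y r = b at hr
    fin_cases a <;> fin_cases b <;> simp_all
  by_contra h0
  exact h3 (mul_left_cancel₀ h0 (by simpa [mul_comm] using hc'))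

theorem IsRotInvariant.apply_swap {n : ℕ} {X : Operator n} (hX : IsRotInvariant X)
    (x y : Fin n → Fin 2) : X (Equiv.swap 0 1 ∘ x) (Equiv.swap 0 1 ∘ y) = X x y := by
  let N : Matrix (Fin 2) (Fin 2) ℂ := Matrix.of fun a b => if a = Equiv.swap 0 1 b then 1 else 0
  have hN : ∀ x y : Fin n → Fin 2,
      tensorPower n N x y = if x = Equiv.swap 0 1 ∘ y then 1 else 0 := by
    intro x y
    simp [tensorPower, N, Finset.prod_boole, funext_iff]
  have h := congrFun (congrFun (hX.commute_tensorPower N).eq (Equiv.swap 0 1 ∘ x)) y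
  have hx : ∀ z : Fin n → Fin 2,
      (Equiv.swap (0 : Fin 2) 1 ∘ x = Equiv.swap 0 1 ∘ z) ↔ x = z := fun z =>
    (Equiv.injective _).comp_left.eq_iff
  simpa [Matrix.mul_apply, hN, hx] using h

/-- Weight conservation removes off-diagonal entries; flipping all qubits identifies the two
possible diagonal values. -/
theorem exists_eq_smul_one_of_isLocal_one {n : ℕ} {X : Operator n} (hX : IsRotInvariant X)
    (hl : IsLocal 1 X) : ∃ c : ℂ, X = c • 1 := by
  obtain ⟨S, hS, B, hB⟩ := hl
  refine ⟨X 0 0, ?_⟩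
  have hdiag : ∀ x, X x x = X 0 0 := by
    have hBx : ∀ x, X x x = B (fun i => x i) (fun i => x i) := fun x => by
      rw [hB, if_pos fun _ _ => rfl]
    intro x
    by_cases hx : ∀ i ∈ S, x i = 0
    · rw [hBx, hBx]
      have : (fun i : S => x i) = fun i : S => (0 : Fin n → Fin 2) i := by
        funext i
        exact hx i i.2
      rw [this]
    · push Not at hx
      obtain ⟨r, hr, hxr⟩ := hx
      rw [← hX.apply_swap 0 0, hBx, hBx]
      have : (fun i : S => x i) = fun i : S => (Equiv.swap 0 1 ∘ (0 : Fin n → Fin 2)) i := by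
        funext i
        rw [Finset.card_le_one.mp hS i i.2 r hr]
        simp
        omega
      rw [this]
  ext x y
  rw [Matrix.smul_apply, Matrix.one_apply, smul_eq_mul, mul_ite, mul_one, mul_zero]
  split_ifs with h
  · rw [← h, hdiag]
  · rw [hB]
    split_ifs with hxy
    · obtain ⟨r, hr⟩ := Function.ne_iff.mp h
      have hrS : r ∈ S := by
        by_contra h'
        exact hr (hxy r h')
      have h0 := hX.apply_eq_zero r hr fun i hi =>
        hxy i fun hiS => hi (Finset.card_le_one.mp hS i hiS r hrS)
      rwa [hB, if_pos hxy] at h0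
    · rfl

theorem exists_eq_smul_one_of_mem {n k : ℕ} (hk : k ≤ 1) {A : Operator n}
    (hA : A ∈ localLieAlgebra n k) : ∃ c : ℂ, A = c • 1 := by
  refine LieSubalgebra.lieSpan_induction (R := ℝ) (p := fun A _ => ∃ c : ℂ, A = c • 1)
    ?_ ?_ ?_ ?_ ?_ hA
  · rintro X ⟨_, ⟨S, hS, h2⟩, h3⟩
    exact exists_eq_smul_one_of_isLocal_one h3 ⟨S, hS.trans hk, h2⟩
  · exact ⟨0, (zero_smul _ _).symm⟩
  · rintro _ _ _ _ ⟨c, rfl⟩ ⟨d, rfl⟩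
    exact ⟨c + d, (add_smul _ _ _).symm⟩
  · rintro r _ _ ⟨c, rfl⟩
    exact ⟨r • c, (smul_assoc _ _ _).symm⟩
  · rintro _ _ _ _ ⟨c, rfl⟩ ⟨d, rfl⟩
    refine ⟨0, ?_⟩
    rw [zero_smul, ← commute_iff_lie_eq]
    exact ((Commute.one_left _).smul_left c).trans rfl

/-! ### Central elements as combinations of the `C_l` -/

theorem isPermInvariant_of_central {n k : ℕ} {A : Operator n} (hA : A ∈ localLieAlgebra n k)
    (hc : ∀ F ∈ localLieAlgebra n k, Commute F A) : IsPermInvariant A := by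
  refine isPermInvariant_of_commute_swapOperator fun r s hrs => ?_
  by_cases hk : 2 ≤ k
  · have h := (hc _ (I_smul_exchange_mem hk hrs)).smul_left (-Complex.I)
    rw [smul_smul, neg_mul, Complex.I_mul_I, neg_neg, one_smul,
      exchange_eq_swapOperator_sub hrs] at h
    simpa using h.add_left ((Commute.one_left A).smul_left (1 / 2 : ℂ))
  · obtain ⟨c, rfl⟩ := exists_eq_smul_one_of_mem (by omega) hA
    exact (Commute.one_right _).smul_right c

theorem diagTrace_mem_map_span {n k : ℕ} {f : (Fin 2 → ℂ) → ℂ} (hf : f ∈ evenForms n k) :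
    ∃ b : ℕ → ℂ, f = diagTrace n (∑ j ∈ Finset.range (k / 2 + 1), b j • opC n (2 * j)) := by
  induction hf using Submodule.span_induction with
  | mem f h =>
    obtain ⟨j, hj, hn, rfl⟩ := h
    obtain ⟨c, hc, h⟩ := diagTrace_opC (even_two_mul j) hn
    refine ⟨Pi.single j c⁻¹, ?_⟩
    rw [Finset.sum_eq_single_of_mem j (Finset.mem_range.mpr (by omega)), map_smul, h,
      Pi.single_eq_same, smul_smul, inv_mul_cancel₀ hc, one_smul,
      Nat.mul_div_cancel_left j two_pos]
    intro i _ hi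
    rw [Pi.single_eq_of_ne hi, zero_smul]
  | zero => exact ⟨0, by simp⟩
  | add f g _ _ hf hg =>
    obtain ⟨b, rfl⟩ := hf
    obtain ⟨b', rfl⟩ := hg
    exact ⟨b + b', by simp only [← map_add, ← Finset.sum_add_distrib, Pi.add_apply, add_smul]⟩
  | smul c f _ hf =>
    obtain ⟨b, rfl⟩ := hf
    exact ⟨c • b, by simp only [← map_smul, Finset.smul_sum, Pi.smul_apply, smul_assoc]⟩

theorem central_eq_sum {n k : ℕ} {A : Operator n} (hA : A ∈ localLieAlgebra n k)
    (hc : ∀ F ∈ localLieAlgebra n k, Commute F A) :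
    ∃ b : ℕ → ℝ, A = ∑ j ∈ Finset.range (k / 2 + 1), b j • (Complex.I • opC n (2 * j)) := by
  obtain ⟨h1, h2, h3⟩ := mem_localLieAlgebra_properties hA
  obtain ⟨b, hb⟩ := diagTrace_mem_map_span h3
  set Y := ∑ j ∈ Finset.range (k / 2 + 1), b j • opC n (2 * j) with hY
  have hYrot : IsRotInvariant Y := IsRotInvariant.sum fun j _ => (isRotInvariant_opC _ _).smul _
  have hperm : IsPermInvariant (A - Y) := by
    intro σ x y
    simp only [hY, Matrix.sub_apply, Matrix.sum_apply, Matrix.smul_apply,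
      isPermInvariant_of_central hA hc σ x y, isPermInvariant_opC _ _ σ x y]
  have hAY : A = Y := sub_eq_zero.mp <|
    (h1.sub hYrot).eq_zero hperm (by rw [map_sub, hb, sub_self])
  -- `A` equals its skew-Hermitian part and `C_l` is Hermitian, so only `i · Im b` survives from
  -- each coefficient.
  refine ⟨fun j => (b j).im, ?_⟩
  have h4 : A = (1 / 2 : ℂ) • (A - Aᴴ) := by
    rw [eq_neg_of_add_eq_zero_right h2, sub_neg_eq_add, ← two_smul ℂ A, smul_smul]
    norm_num
  rw [h4, hAY, hY, Matrix.conjTranspose_sum, ← Finset.sum_sub_distrib, Finset.smul_sum]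
  refine Finset.sum_congr rfl fun j _ => ?_
  rw [Matrix.conjTranspose_smul, conjTranspose_opC (even_two_mul j), ← sub_smul, smul_smul,
    ← Complex.coe_smul, smul_smul]
  congr 1
  apply Complex.ext <;> simp
  ring

/-! ### The center and its dimension -/

theorem mem_center_iff {n k : ℕ} (A : localLieAlgebra n k) :
    A ∈ LieAlgebra.center ℝ (localLieAlgebra n k) ↔
      ∀ F ∈ localLieAlgebra n k, Commute F (A : Operator n) := by
  rw [LieModule.mem_maxTrivSubmodule]
  refine ⟨fun h F hF => ?_, fun h F => ?_⟩
  · rw [commute_iff_lie_eq]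
    exact congrArg Subtype.val (h ⟨F, hF⟩)
  · exact Subtype.ext (commute_iff_lie_eq.mp (h F F.2))

theorem map_center_eq_span (n k : ℕ) :
    (LieAlgebra.center ℝ (localLieAlgebra n k)).toSubmodule.map
        (localLieAlgebra n k).toSubmodule.subtype =
      Submodule.span ℝ
        {A : Operator n | ∃ l : ℕ, Even l ∧ l ≤ 2 * (k / 2) ∧ A = Complex.I • opC n l} := by
  apply le_antisymm
  · rintro _ ⟨A, hA, rfl⟩
    obtain ⟨b, hb⟩ := central_eq_sum A.2 ((mem_center_iff A).mp hA)
    change (A : Operator n) ∈ _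
    rw [hb]
    refine Submodule.sum_mem _ fun j hj => Submodule.smul_mem _ _ (Submodule.subset_span ?_)
    exact ⟨2 * j, even_two_mul j, by have := Finset.mem_range.mp hj; omega, rfl⟩
  · rw [Submodule.span_le]
    rintro _ ⟨l, hl, hk, rfl⟩
    refine ⟨⟨_, I_smul_opC_mem hl (by omega)⟩, (mem_center_iff _).mpr fun F hF => ?_, rfl⟩
    exact ((mem_localLieAlgebra_properties hF).1.commute_of_isPermInvariant
      (isPermInvariant_opC n l)).smul_right _

theorem linearIndependent_I_smul_opC {n k : ℕ} (hk : k ≤ n) :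
    LinearIndependent ℝ fun j : Fin (k / 2 + 1) => Complex.I • opC n (2 * j) := by
  rw [Fintype.linearIndependent_iff]
  intro g hg
  have hc := fun j : Fin (k / 2 + 1) =>
    diagTrace_opC (n := n) (even_two_mul (j : ℕ)) (by omega)
  choose c hc0 hc using hc
  let P : Polynomial ℂ := ∑ j : Fin (k / 2 + 1),
    Polynomial.monomial (2 * (j : ℕ)) (g j * (Complex.I * c j))
  have hP : P = 0 := by
    refine Polynomial.funext fun s => ?_
    -- On the line `λ₀+λ₁ = 1`, `λ₀-λ₁ = s` the forms become the distinct monomials `s^{2j}`. The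
    -- bound `k ≤ n` keeps every `C_{2j}` involved nonzero.
    have h := congrFun (congrArg (diagTrace n) hg) ![(1 + s) / 2, (1 - s) / 2]
    have h1 : (1 + s) / 2 + (1 - s) / 2 = 1 := by ring
    have h2 : (1 + s) / 2 - (1 - s) / 2 = s := by ring
    simp only [← Complex.coe_smul, map_sum, map_smul, hc, map_zero, Finset.sum_apply,
      Pi.smul_apply, smul_eq_mul, evenForm, Matrix.cons_val_zero, Matrix.cons_val_one, h1, h2,
      one_pow, one_mul, Nat.mul_div_cancel_left _ two_pos, Pi.zero_apply] at h
    rw [Polynomial.eval_finsetSum, Polynomial.eval_zero, ← h]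
    refine Finset.sum_congr rfl fun j _ => ?_
    rw [Polynomial.eval_monomial]
    ring
  intro j
  have h := congrArg (fun p => p.coeff (2 * (j : ℕ))) hP
  simp only [P, Polynomial.finsetSum_coeff, Polynomial.coeff_monomial, Polynomial.coeff_zero] at h
  rw [Finset.sum_eq_single_of_mem j (Finset.mem_univ j), if_pos rfl] at h
  · simpa [hc0 j] using h
  · intro i _ hi
    rw [if_neg]
    intro h'
    exact hi (Fin.ext (by omega))

theorem finrank_center {n k : ℕ} (hk : k ≤ n) :
    Module.finrank ℝ (LieAlgebra.center ℝ (localLieAlgebra n k)) = k / 2 + 1 := by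
  have hset : {A : Operator n | ∃ l : ℕ, Even l ∧ l ≤ 2 * (k / 2) ∧ A = Complex.I • opC n l} =
      Set.range fun j : Fin (k / 2 + 1) => Complex.I • opC n (2 * j) := by
    ext A
    constructor
    · rintro ⟨l, ⟨m, rfl⟩, hl, rfl⟩
      exact ⟨⟨m, by omega⟩, by simp [two_mul]⟩
    · rintro ⟨j, rfl⟩
      exact ⟨2 * j, even_two_mul _, by omega, rfl⟩
  have h := finrank_span_eq_card (linearIndependent_I_smul_opC hk)
  rw [← hset, ← map_center_eq_span, Fintype.card_fin] at h
  rw [← h]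
  exact (LinearEquiv.finrank_eq (Submodule.equivMapOfInjective _
    (Submodule.subtype_injective _) _))

end Qubits

theorem mainTheorem7 (n k : ℕ) :
    (LieAlgebra.center ℝ (Qubits.localLieAlgebra n k)).toSubmodule.map
        (Qubits.localLieAlgebra n k).toSubmodule.subtype =
      Submodule.span ℝ
        {A : Qubits.Operator n |
          ∃ l : ℕ, Even l ∧ l ≤ 2 * (k / 2) ∧ A = Complex.I • Qubits.opC n l} ∧
    (k ≤ n →
      Module.finrank ℝ (LieAlgebra.center ℝ (Qubits.localLieAlgebra n k)) = k / 2 + 1) :=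
  ⟨Qubits.map_center_eq_span n k, Qubits.finrank_center⟩
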